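/- For a group $P$ and an element $g\in P$, let $k_P(g)$ be the minimum of the orders $|Q|$ over the finite quotients $Q$ of $P$ in which the image of $g$ is nontrivial ($k_P(g)=\infty$ if there is none). For a finite generating set $S$ of $P$, let $\|g\|_S$ be the word length of $g$ with respect to $S$, and let $F_P^S(n)$ be the maximum of $k_P(g)$ over all $g\in P\setminus\{1\}$ with $\|g\|_S\le n$ (and $0$ if there are no such $g$). Let the Hirsch number $h(P)$ be the number of infinite cyclic factors in a finite subnormal series of $P$ whose factors are cyclic or finite (this number does not depend on the series). Theorem. Let $P$ be a finitely generated nilpotent group. Then for every finite generating set $S$ of $P$ we have $F_P^S(n)\preceq (\log n)^{h(P)}$; that is, there is a positive integer $C$ such that $$F_P^S(n)\le C\,\bigl(\log (Cn)\bigr)^{h(P)}\qquad\text{for all integers } n\ge 1 .$$ -/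

import Mathlib

open scoped ENNReal

noncomputable section

namespace ResidualFiniteness

/-- The word length of `g` with respect to `S`: the least length of a word in the letters
`S ∪ S⁻¹` that represents `g` (and `⊤` if there is no such word). -/
def wordLength {G : Type*} [Group G] (S : Set G) (g : G) : ℕ∞ :=
  ⨅ (l : List G) (_ : (∀ x ∈ l, x ∈ S ∨ x⁻¹ ∈ S) ∧ l.prod = g), (l.length : ℕ∞)

/-- `k_G(g)`: the least order of a finite quotient `G ⧸ N` in which the image of `g` is nontrivial
(and `⊤` if there is no such quotient). -/
def minQuotient {G : Type*} [Group G] (g : G) : ℕ∞ :=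
  ⨅ (N : Subgroup G) (_ : N.Normal ∧ Finite (G ⧸ N) ∧ g ∉ N), (Nat.card (G ⧸ N) : ℕ∞)

/-- `F_G^S(n)`: the largest value of `k_G(g)` over the nontrivial `g` of word length at most `n`.
It is `⊤` as soon as one of these elements survives in no finite quotient. -/
def growth {G : Type*} [Group G] (S : Set G) (n : ℕ) : ℕ∞ :=
  ⨆ (g : G) (_ : g ≠ 1 ∧ wordLength S g ≤ n), minQuotient g

/-- The relation `f₁ ≼ f₂`: there is a constant `C` with `f₁ n ≤ C * f₂ (C * n)` for all positive
integers `n`. -/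
def AsympLE (f₁ f₂ : ℕ → ℝ≥0∞) : Prop :=
  ∃ C : ℕ, 0 < C ∧ ∀ n : ℕ, 0 < n → f₁ n ≤ (C : ℝ≥0∞) * f₂ (C * n)

/-- A finite subnormal series `1 = H₀ ⊴ H₁ ⊴ ⋯ ⊴ H_m = G` all of whose factors
`H_{i+1} ⧸ H_i` are cyclic or finite. Only the terms with index at most `m` matter. -/
structure CyclicOrFiniteSeries (G : Type*) [Group G] where
  /-- The number `m` of factors. -/
  length : ℕ
  /-- The terms of the series. -/
  term : ℕ → Subgroup G
  term_zero : term 0 = ⊥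
  term_length : term length = ⊤
  le_succ : ∀ i < length, term i ≤ term (i + 1)
  normal : ∀ i < length, ((term i).subgroupOf (term (i + 1))).Normal
  cyclic_or_finite : ∀ i, ∀ hi : i < length,
    (haveI := normal i hi; IsCyclic (term (i + 1) ⧸ (term i).subgroupOf (term (i + 1)))) ∨
      Finite (term (i + 1) ⧸ (term i).subgroupOf (term (i + 1)))

/-- The number of infinite factors (which are then infinite cyclic) of a series with cyclic or
finite factors. -/
def CyclicOrFiniteSeries.infiniteFactors {G : Type*} [Group G] (s : CyclicOrFiniteSeries G) : ℕ :=
  Set.ncard {i : ℕ | i < s.length ∧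
    Infinite (s.term (i + 1) ⧸ (s.term i).subgroupOf (s.term (i + 1)))}

/-- The Hirsch number of `G`: the number of infinite cyclic factors in a series with cyclic or
finite factors. All such series of `G` have the same number of infinite factors, so that taking
the least one is no restriction. -/
def hirschNumber (G : Type*) [Group G] : ℕ :=
  sInf (Set.range (CyclicOrFiniteSeries.infiniteFactors (G := G)))

end ResidualFiniteness

end

open scoped commutatorElement

/-! Finite quotients are found by dividing out power subgroups. A finitely generated nilpotent group
has a finite-index subgroup `L` whose identity is separated from its other elements by finitely many
integer-valued polynomial functions (`IsPolycyclic.exists_hasSeparatingPolys`). Such a function `f`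
has two properties. It grows polynomially in word length (`IsPolyOn.growth`). For a prime `p` not
below its degree bound it is constant modulo `p` on the subgroup generated by `p`-th powers
(`IsPolyOn.dvd_of_mem_powSubgroup`).

If `g` in `L` is nontrivial of length at most `n`, some `f g - f 1` is a nonzero integer of
polynomial size. Chebyshev's bound gives a prime `p = O(log n)` not dividing it
(`exists_prime_not_dvd`), so `g` survives modulo `p`-th powers of `L`, hence modulo `m * p`-th
powers of the group, where `m`-th powers lie in `L`. That quotient has order `O((m * p) ^ h)`, since
only infinite cyclic layers of a series contribute a growing factor
(`CyclicOrFiniteSeries.exists_coveredBy`).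

The polynomials are built by induction along a polycyclic series. Nilpotency enters when they are
extended over an infinite cyclic layer: conjugation raises lower central weight, so a weighted
degree still drops (`IsWeightedOn.twisted_sub`). -/

namespace ResidualFiniteness

variable {G : Type*} [Group G]

/-! ### Polynomial functions: growth and congruences modulo primes. -/

/-- `f` is polynomial of degree less than `d` on the subgroup `L`: it vanishes on `L` after taking
`d` left differences with respect to elements of `L`. -/
def IsPolyOn (L : Subgroup G) : ℕ → (G → ℤ) → Prop
  | 0, f => ∀ z ∈ L, f z = 0
  | d + 1, f => ∀ y ∈ L, IsPolyOn L d (fun z => f (y * z) - f z)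

theorem IsPolyOn.congr {L : Subgroup G} {d : ℕ} {f g : G → ℤ} (hf : IsPolyOn L d f)
    (h : ∀ z ∈ L, f z = g z) : IsPolyOn L d g := by
  induction d generalizing f g with
  | zero => intro z hz; rw [← h z hz]; exact hf z hz
  | succ d ih =>
    intro y hy
    exact ih (hf y hy) fun z hz => by rw [h z hz, h _ (L.mul_mem hy hz)]

theorem IsPolyOn.mono_subgroup {L K : Subgroup G} {d : ℕ} {f : G → ℤ} (hf : IsPolyOn L d f)
    (h : K ≤ L) : IsPolyOn K d f := by
  induction d generalizing f with
  | zero => exact fun z hz => hf z (h hz)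
  | succ d ih => exact fun y hy => ih (hf y (h hy))

/-- A polynomial function grows polynomially in the word length. -/
theorem IsPolyOn.growth {L : Subgroup G} {d : ℕ} {f : G → ℤ} (hf : IsPolyOn L d f)
    (U : Finset G) (hU : ∀ u ∈ U, u ∈ L) :
    ∃ C : ℕ, ∀ l : List G, (∀ u ∈ l, u ∈ U) → |f l.prod| ≤ C * (l.length + 1) ^ d := by
  induction d generalizing f with
  | zero =>
    refine ⟨0, fun l hl => ?_⟩
    rw [hf _ (L.list_prod_mem fun u hu => hU u (hl u hu))]
    simp
  | succ d ih =>
    choose! C hC using fun u hu => ih (hf u (hU u hu))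
    -- Removing the letters one at a time telescopes `f` down to `f 1`; each removal costs one
    -- difference, bounded by induction.
    refine ⟨(f 1).natAbs + ∑ u ∈ U, C u, fun l => ?_⟩
    have key : ∀ l : List G, (∀ u ∈ l, u ∈ U) →
        |f l.prod| ≤ |f 1| + l.length * ((∑ u ∈ U, C u : ℕ) * ((l.length : ℤ) + 1) ^ d) := by
      intro l
      induction l with
      | nil => simp
      | cons u l ihl =>
        intro hl
        have hu : u ∈ U := hl u (by simp)
        have hl' : ∀ v ∈ l, v ∈ U := fun v hv => hl v (by simp [hv])
        have h1 := hC u hu l hl'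
        have h2 := ihl hl'
        have h3 : (C u : ℤ) ≤ (∑ u ∈ U, C u : ℕ) := by
          exact_mod_cast Finset.single_le_sum (f := C) (fun _ _ => Nat.zero_le _) hu
        rw [List.prod_cons, List.length_cons]
        have h4 : |f (u * l.prod)| ≤ |f (u * l.prod) - f l.prod| + |f l.prod| := by
          simpa using abs_add_le (f (u * l.prod) - f l.prod) (f l.prod)
        have h5 : ((l.length : ℤ) + 1) ^ d ≤ ((l.length : ℤ) + 1 + 1) ^ d := by gcongr; omega
        have h6 : (C u : ℤ) * ((l.length : ℤ) + 1) ^ d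
            ≤ (∑ u ∈ U, C u : ℕ) * ((l.length : ℤ) + 1 + 1) ^ d := by gcongr
        have h7 : (l.length : ℤ) * ((∑ u ∈ U, C u : ℕ) * ((l.length : ℤ) + 1) ^ d)
            ≤ l.length * ((∑ u ∈ U, C u : ℕ) * ((l.length : ℤ) + 1 + 1) ^ d) := by gcongr
        push_cast at *
        linarith
    intro hl
    refine (key l hl).trans ?_
    have h1 : (1 : ℤ) ≤ ((l.length : ℤ) + 1) ^ (d + 1) := one_le_pow₀ (by omega)
    have h2 : |f 1| ≤ |f 1| * ((l.length : ℤ) + 1) ^ (d + 1) :=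
      le_mul_of_one_le_right (abs_nonneg _) h1
    have h3 : (l.length : ℤ) * ((∑ u ∈ U, C u : ℕ) * ((l.length : ℤ) + 1) ^ d)
        ≤ ((l.length : ℤ) + 1) * ((∑ u ∈ U, C u : ℕ) * ((l.length : ℤ) + 1) ^ d) := by
      gcongr; omega
    push_cast at *
    rw [pow_succ] at *
    nlinarith

/-- A forward difference in the exponent `j` is a left difference by `x`. -/
theorem IsPolyOn.iterate_fwdDiff {L : Subgroup G} {d : ℕ} {f : G → ℤ} (hf : IsPolyOn L d f)
    {x y : G} (hx : x ∈ L) (hy : y ∈ L) (k : ℕ) (hk : d ≤ k) :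
    ((fwdDiff 1)^[k] (fun j : ℕ => f (x ^ j * y))) = 0 := by
  induction k generalizing f d with
  | zero =>
    obtain rfl : d = 0 := by omega
    funext j
    exact hf _ (L.mul_mem (L.pow_mem hx j) hy)
  | succ k ih =>
    rw [Function.iterate_succ_apply]
    have : fwdDiff 1 (fun j : ℕ => f (x ^ j * y))
        = fun j : ℕ => (fun z => f (x * z) - f z) (x ^ j * y) := by
      funext j
      simp only [fwdDiff, pow_succ', mul_assoc]
    rw [this]
    cases d with
    | zero =>
      refine ih (d := 0) (f := fun z => f (x * z) - f z) (fun z hz => ?_) (Nat.zero_le _)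
      simp [hf z hz, hf _ (L.mul_mem hx hz)]
    | succ d => exact ih (hf x hx) (by omega)

/-- Modulo a prime `p` not below the degree, a polynomial function does not see `p`-th powers. -/
theorem IsPolyOn.pow_prime_mul {L : Subgroup G} {d : ℕ} {f : G → ℤ} (hf : IsPolyOn L d f)
    {p : ℕ} (hp : p.Prime) (hdp : d ≤ p) {x y : G} (hx : x ∈ L) (hy : y ∈ L) :
    (p : ℤ) ∣ f (x ^ p * y) - f y := by
  have h := shift_eq_sum_fwdDiff_iter (1 : ℕ) (fun j : ℕ => f (x ^ j * y)) p 0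
  simp only [smul_eq_mul, mul_one, zero_add] at h
  -- In Newton's expansion the term `j = p` vanishes by the degree bound and `j = 0` is `f y`; the
  -- others carry a binomial coefficient divisible by `p`.
  rw [h, Finset.sum_range_succ, hf.iterate_fwdDiff hx hy p hdp,
    ← Finset.sum_erase_add _ _ (Finset.mem_range.2 hp.pos)]
  simp only [Nat.choose_zero_right, Function.iterate_zero, id, pow_zero, one_mul, one_smul,
    Pi.zero_apply, smul_zero, add_zero, add_sub_cancel_right]
  refine Finset.dvd_sum fun j hj => ?_
  rw [Finset.mem_erase, Finset.mem_range] at hj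
  rw [nsmul_eq_mul]
  exact Dvd.dvd.mul_right (Int.natCast_dvd_natCast.2 (hp.dvd_choose_self hj.1 hj.2)) _

/-- The subgroup generated by the `m`-th powers of the elements of `H`. -/
def powSubgroup (H : Subgroup G) (m : ℕ) : Subgroup G :=
  Subgroup.closure ((fun x => x ^ m) '' (H : Set G))

theorem pow_mem_powSubgroup {H : Subgroup G} {x : G} (hx : x ∈ H) (m : ℕ) :
    x ^ m ∈ powSubgroup H m :=
  Subgroup.subset_closure ⟨x, hx, rfl⟩

theorem powSubgroup_le {H K : Subgroup G} {m : ℕ} (h : ∀ x ∈ H, x ^ m ∈ K) :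
    powSubgroup H m ≤ K := by
  rw [powSubgroup, Subgroup.closure_le]
  rintro _ ⟨x, hx, rfl⟩
  exact h x hx

theorem conj_mem_powSubgroup {H : Subgroup G} {m : ℕ} {y : G}
    (hy : ∀ h ∈ H, y * h * y⁻¹ ∈ H) {v : G} (hv : v ∈ powSubgroup H m) :
    y * v * y⁻¹ ∈ powSubgroup H m := by
  have : powSubgroup H m ≤ (powSubgroup H m).comap (MulAut.conj y).toMonoidHom := by
    refine powSubgroup_le fun x hx => ?_
    simpa [conj_pow] using pow_mem_powSubgroup (hy x hx) m
  simpa using this hv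

theorem IsPolyOn.dvd_of_mem_powSubgroup {L : Subgroup G} {d : ℕ} {f : G → ℤ}
    (hf : IsPolyOn L d f) {p : ℕ} (hp : p.Prime) (hdp : d ≤ p) {g : G}
    (hg : g ∈ powSubgroup L p) : (p : ℤ) ∣ f g - f 1 := by
  -- A free right factor `y` lets the congruences be chained over products.
  have key : ∀ y ∈ L, (p : ℤ) ∣ f (g * y) - f y := by
    have hL : powSubgroup L p ≤ L := powSubgroup_le fun x hx => L.pow_mem hx p
    induction hg using Subgroup.closure_induction with
    | mem g hg =>
      obtain ⟨x, hx, rfl⟩ := hg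
      exact fun y hy => hf.pow_prime_mul hp hdp hx hy
    | one => simp
    | mul a b ha hb iha ihb =>
      intro y hy
      have := (iha (b * y) (L.mul_mem (hL hb) hy)).add (ihb y hy)
      simpa [mul_assoc] using this
    | inv a ha iha =>
      intro y hy
      have := iha (a⁻¹ * y) (L.mul_mem (L.inv_mem (hL ha)) hy)
      rw [mul_inv_cancel_left] at this
      exact (dvd_sub_comm).1 this
  simpa using key 1 L.one_mem

/-! ### Weighted degree and extension over an infinite cyclic factor. -/

/-- The functions which vanish on `N` after taking differences with respect to any elements of `N`
of total weight at least `k`, where the `i`-th term of the lower central series of the ambient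
group has weight `i + 1`. -/
def IsWeightedOn (N : Subgroup G) : ℕ → (G → ℤ) → Prop
  | 0, f => ∀ z ∈ N, f z = 0
  | k + 1, f => ∀ i, ∀ n ∈ N, n ∈ (⊤ : Subgroup G).lowerCentralSeries i →
      IsWeightedOn N (k - i) (fun z => f (n * z) - f z)
termination_by k => k
decreasing_by omega

variable {N : Subgroup G}

theorem isWeightedOn_zero {f : G → ℤ} : IsWeightedOn N 0 f ↔ ∀ z ∈ N, f z = 0 := by
  rw [IsWeightedOn]

theorem isWeightedOn_succ {k : ℕ} {f : G → ℤ} : IsWeightedOn N (k + 1) f ↔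
    ∀ i, ∀ n ∈ N, n ∈ (⊤ : Subgroup G).lowerCentralSeries i →
      IsWeightedOn N (k - i) (fun z => f (n * z) - f z) := by
  rw [IsWeightedOn]

theorem IsWeightedOn.congr {k : ℕ} {f g : G → ℤ} (hf : IsWeightedOn N k f)
    (h : ∀ z ∈ N, f z = g z) : IsWeightedOn N k g := by
  induction k using Nat.strong_induction_on generalizing f g with
  | _ k ih =>
    cases k with
    | zero =>
      rw [isWeightedOn_zero] at *
      exact fun z hz => by rw [← h z hz]; exact hf z hz
    | succ k =>
      rw [isWeightedOn_succ] at *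
      exact fun i n hn hi => ih _ (by omega) (hf i n hn hi) fun z hz => by
        rw [h z hz, h _ (N.mul_mem hn hz)]

theorem isWeightedOn_of_zero {k : ℕ} {f : G → ℤ} (hf : ∀ z ∈ N, f z = 0) :
    IsWeightedOn N k f := by
  induction k using Nat.strong_induction_on generalizing f with
  | _ k ih =>
    cases k with
    | zero => rwa [isWeightedOn_zero]
    | succ k =>
      rw [isWeightedOn_succ]
      exact fun i n hn hi => ih _ (by omega) fun z hz => by
        simp [hf z hz, hf _ (N.mul_mem hn hz)]

theorem IsWeightedOn.succ {k : ℕ} {f : G → ℤ} (hf : IsWeightedOn N k f) :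
    IsWeightedOn N (k + 1) f := by
  induction k using Nat.strong_induction_on generalizing f with
  | _ k ih =>
    cases k with
    | zero => exact isWeightedOn_of_zero (isWeightedOn_zero.1 hf)
    | succ k =>
      rw [isWeightedOn_succ] at hf ⊢
      intro i n hn hi
      rcases le_or_gt i k with h | h
      · rw [show k + 1 - i = (k - i) + 1 by omega]
        exact ih _ (by omega) (hf i n hn hi)
      · have := hf i n hn hi
        rw [show k - i = 0 by omega, isWeightedOn_zero] at this
        exact isWeightedOn_of_zero this

theorem IsWeightedOn.add {k : ℕ} {f g : G → ℤ} (hf : IsWeightedOn N k f)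
    (hg : IsWeightedOn N k g) : IsWeightedOn N k (fun z => f z + g z) := by
  induction k using Nat.strong_induction_on generalizing f g with
  | _ k ih =>
    cases k with
    | zero =>
      rw [isWeightedOn_zero] at *
      exact fun z hz => by rw [hf z hz, hg z hz, add_zero]
    | succ k =>
      rw [isWeightedOn_succ] at *
      exact fun i n hn hi => (ih _ (by omega) (hf i n hn hi) (hg i n hn hi)).congr
        fun z _ => by ring

theorem IsWeightedOn.comp_mul_left {k : ℕ} {f : G → ℤ} (hf : IsWeightedOn N k f) {n : G}
    (hn : n ∈ N) : IsWeightedOn N k (fun z => f (n * z)) := by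
  have h : IsWeightedOn N k (fun z => f (n * z) - f z) := by
    have := isWeightedOn_succ.1 hf.succ 0 n hn (by simp)
    simpa using this
  exact (h.add hf).congr fun z _ => by ring

/-- Differences by elements of index above `c` are trivial. All others have weight at most `c + 1`,
so total weight `(c + 1) * d` forces at least `d` of them. -/
theorem IsPolyOn.isWeightedOn {c : ℕ} (hc : (⊤ : Subgroup G).lowerCentralSeries c = ⊥) {d : ℕ}
    {f : G → ℤ} (hf : IsPolyOn N d f) {k : ℕ} (hk : (c + 1) * d ≤ k) : IsWeightedOn N k f := by
  induction d generalizing f k with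
  | zero => exact isWeightedOn_of_zero hf
  | succ d ih =>
    obtain ⟨k, rfl⟩ : ∃ j, k = j + 1 := ⟨k - 1, by rw [mul_add] at hk; omega⟩
    rw [isWeightedOn_succ]
    intro i n hn hi
    rcases le_or_gt i c with h | h
    · exact ih (hf n hn) (by rw [mul_add] at hk; omega)
    · have h1 : n ∈ (⊤ : Subgroup G).lowerCentralSeries c :=
        Subgroup.lowerCentralSeries_antitone _ h.le hi
      rw [hc, Subgroup.mem_bot] at h1
      exact isWeightedOn_of_zero fun z _ => by simp [h1]

/-- A difference with respect to an element `y` that acts on `N` by `z ↦ y * z * t` (such as a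
product of an element of `N` and a conjugation) lowers the weight. -/
theorem IsWeightedOn.twisted_sub {k : ℕ} {f : G → ℤ} (hf : IsWeightedOn N (k + 1) f) {y t : G}
    (hyN : ∀ z ∈ N, y * z * y⁻¹ ∈ N) (hyt : ∀ z ∈ N, y * z * t ∈ N) :
    IsWeightedOn N k (fun z => f (y * z * t) - f z) := by
  induction k using Nat.strong_induction_on generalizing f with
  | _ k ih =>
    cases k with
    | zero =>
      rw [isWeightedOn_zero]
      intro z hz
      have := isWeightedOn_zero.1 (isWeightedOn_succ.1 hf 0 (y * z * t * z⁻¹)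
        (N.mul_mem (hyt z hz) (N.inv_mem hz)) (by simp)) z hz
      simpa using this
    | succ k =>
      rw [isWeightedOn_succ]
      intro i n hn hi
      -- With `n' = y * n * y⁻¹` and `u = n' * n⁻¹`, the `n`-difference of the twisted difference of
      -- `f` is the twisted difference of the `n'`-difference (induction) plus the `u`-difference at
      -- `n * z`. The commutator `u` lies one step deeper, which pays for the lost weight.
      have hn' := hyN n hn
      have hu : y * n * y⁻¹ * n⁻¹ ∈ N := N.mul_mem hn' (N.inv_mem hn)
      have hui : y * n * y⁻¹ * n⁻¹ ∈ (⊤ : Subgroup G).lowerCentralSeries (i + 1) := by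
        rw [Subgroup.lowerCentralSeries_succ, Subgroup.commutator_comm]
        exact Subgroup.commutator_mem_commutator (Subgroup.mem_top y) hi
      have hi' : y * n * y⁻¹ ∈ (⊤ : Subgroup G).lowerCentralSeries i := by
        have := mul_mem (Subgroup.lowerCentralSeries_antitone _ (Nat.le_succ i) hui) hi
        simpa using this
      have h1 := isWeightedOn_succ.1 hf i _ hn' hi'
      have h2 := (isWeightedOn_succ.1 hf (i + 1) _ hu hui).comp_mul_left hn
      rw [show k + 1 - (i + 1) = k - i by omega] at h2
      have h3 : IsWeightedOn N (k - i) (fun z =>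
          (fun z => f (y * n * y⁻¹ * z) - f z) (y * z * t)
            - (fun z => f (y * n * y⁻¹ * z) - f z) z) := by
        rcases le_or_gt i k with h | h
        · rw [show k + 1 - i = (k - i) + 1 by omega] at h1
          exact ih _ (by omega) h1
        · rw [show k + 1 - i = 0 by omega, isWeightedOn_zero] at h1
          refine isWeightedOn_of_zero fun z hz => ?_
          beta_reduce
          rw [h1 z hz, h1 _ (hyt z hz), sub_zero]
      refine (h3.add h2).congr fun z _ => ?_
      have e1 : y * n * y⁻¹ * (y * z * t) = y * (n * z) * t := by group
      have e2 : y * n * y⁻¹ * n⁻¹ * (n * z) = y * n * y⁻¹ * z := by group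
      simp only [e1, e2]
      ring

/-- Polynomial functions extend along a split extension by an infinite cyclic group. -/
theorem IsWeightedOn.isPolyOn_extend {L : Subgroup G} {x : G} {κ : G → ℤ}
    (hκ : ∀ y ∈ L, ∀ z ∈ L, κ (y * z) = κ y + κ z) (hκN : ∀ z ∈ L, z * x ^ (-κ z) ∈ N)
    (hNL : N ≤ L) (hN : ∀ n ∈ N, κ n = 0) (hL : ∀ y ∈ L, ∀ z ∈ N, y * z * y⁻¹ ∈ N)
    {k : ℕ} {f : G → ℤ} (hf : IsWeightedOn N k f) :
    IsPolyOn L k (fun z => f (z * x ^ (-κ z))) := by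
  induction k generalizing f with
  | zero =>
    rw [isWeightedOn_zero] at hf
    exact fun z hz => hf _ (hκN z hz)
  | succ k ih =>
    intro y hy
    -- Left multiplication by `y` acts on the `N`-component `w = z * x ^ (-κ z)` as `w ↦ y * w * x ^
    -- (-κ y)`.
    have h := hf.twisted_sub (hL y hy) (t := x ^ (-κ y)) fun z hz => by
      have := hκN (y * z) (L.mul_mem hy (hNL hz))
      rwa [hκ y hy z (hNL hz), hN z hz, add_zero] at this
    refine (ih h).congr fun z hz => ?_
    simp only [hκ y hy z hz]
    congr 2
    rw [neg_add_rev, zpow_add]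
    group

/-! ### Counting cosets. -/

/-- `H` is covered by at most `N` left cosets of `V`. -/
def CoveredBy (H V : Subgroup G) (N : ℕ) : Prop :=
  ∃ R : Finset G, R.card ≤ N ∧ ∀ h ∈ H, ∃ r ∈ R, r⁻¹ * h ∈ V

theorem coveredBy_of_le {H V : Subgroup G} (h : H ≤ V) : CoveredBy H V 1 :=
  ⟨{1}, by simp, fun x hx => ⟨1, by simp, by simpa using h hx⟩⟩

theorem CoveredBy.trans {K H V : Subgroup G} {M N : ℕ} (hK : CoveredBy K H M)
    (hH : CoveredBy H V N) : CoveredBy K V (M * N) := by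
  classical
  obtain ⟨R, hR, hR'⟩ := hK
  obtain ⟨T, hT, hT'⟩ := hH
  refine ⟨Finset.image₂ (· * ·) R T, (Finset.card_image₂_le _ _ _).trans (Nat.mul_le_mul hR hT),
    fun y hy => ?_⟩
  obtain ⟨r, hr, hr'⟩ := hR' y hy
  obtain ⟨t, ht, ht'⟩ := hT' _ hr'
  exact ⟨r * t, Finset.mem_image₂_of_mem hr ht, by simpa [mul_assoc] using ht'⟩

theorem coveredBy_of_finite (K H : Subgroup G) [Finite (K ⧸ H.subgroupOf K)] :
    CoveredBy K H (Nat.card (K ⧸ H.subgroupOf K)) := by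
  classical
  have := Fintype.ofFinite (K ⧸ H.subgroupOf K)
  refine ⟨Finset.univ.image fun q : K ⧸ H.subgroupOf K => (q.out : G), ?_, fun y hy => ?_⟩
  · rw [Nat.card_eq_fintype_card]
    exact Finset.card_image_le
  · refine ⟨_, Finset.mem_image_of_mem _ (Finset.mem_univ (QuotientGroup.mk (⟨y, hy⟩ : K))), ?_⟩
    have := QuotientGroup.eq.1
      (QuotientGroup.out_eq' (QuotientGroup.mk (⟨y, hy⟩ : K) : K ⧸ H.subgroupOf K))
    simpa [Subgroup.mem_subgroupOf] using this

/-- If `K` is generated by `H` and `x` and `V` contains `x ^ m`, then `K` needs at most `m` times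
as many cosets of `V` as `H`. -/
theorem CoveredBy.cyclic {K H V : Subgroup G} {N m : ℕ} {x : G} (hH : CoveredBy H V N)
    (hm : 0 < m) (hcyc : ∀ y ∈ K, ∃ j : ℤ, x ^ (-j) * y ∈ H) (hx : x ^ m ∈ V)
    (hV : ∀ h ∈ H, ∀ v ∈ V, h⁻¹ * v * h ∈ V) : CoveredBy K V (m * N) := by
  classical
  obtain ⟨R, hR, hR'⟩ := hH
  refine ⟨Finset.image₂ (fun (a : ℕ) r => x ^ a * r) (Finset.range m) R,
    (Finset.card_image₂_le _ _ _).trans (by simpa using Nat.mul_le_mul_left m hR),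
    fun y hy => ?_⟩
  obtain ⟨j, hj⟩ := hcyc y hy
  obtain ⟨r, hr, hr'⟩ := hR' _ hj
  have hm' : (0 : ℤ) < m := by exact_mod_cast hm
  have hnn := Int.emod_nonneg j hm'.ne'
  have hlt := Int.emod_lt_of_pos j hm'
  refine ⟨x ^ (j % m).toNat * r, Finset.mem_image₂_of_mem (by simp; omega) hr, ?_⟩
  -- Write `j` as a multiple of `m` plus a remainder: the multiple gives an element of `V`, which is
  -- moved past `H` by `hV`.
  have h1 := V.mul_mem hr' (hV _ hj _ (V.zpow_mem hx (j / m)))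
  have h2 : x ^ (j % m).toNat = x ^ j * (x ^ m) ^ (-(j / (m : ℤ))) := by
    rw [← zpow_natCast x (j % m).toNat, Int.toNat_of_nonneg hnn, ← zpow_natCast x m, ← zpow_mul,
      ← zpow_add]
    congr 1
    have := Int.mul_ediv_add_emod j m
    linarith
  rw [h2]
  convert h1 using 1
  rw [zpow_neg, zpow_neg]
  group

/-- Pigeonhole on the powers of `h` puts some `h ^ k` with `0 < k ≤ R.card` in `V`; the factorial
serves all such `k` at once. -/
theorem CoveredBy.exists_pow_mem {H V : Subgroup G} {N : ℕ} (h : CoveredBy H V N) :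
    ∃ m : ℕ, 0 < m ∧ ∀ h ∈ H, h ^ m ∈ V := by
  obtain ⟨R, -, hR⟩ := h
  refine ⟨R.card.factorial, Nat.factorial_pos _, fun h hh => ?_⟩
  choose r hrR hr using fun j : ℕ => hR (h ^ j) (H.pow_mem hh j)
  obtain ⟨i, hi, j, hj, hij, he⟩ := Finset.exists_ne_map_eq_of_card_lt_of_maps_to
    (s := Finset.range (R.card + 1)) (t := R) (f := r) (by simp) fun j _ => hrR j
  wlog hlt : i < j generalizing i j
  · exact this j hj i hi hij.symm he.symm (by omega)
  have h1 : h ^ (j - i) ∈ V := by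
    have h2 := V.mul_mem (V.inv_mem (hr i)) (hr j)
    rw [he, mul_inv_rev, inv_inv, mul_assoc, mul_inv_cancel_left] at h2
    rwa [← pow_mul_pow_sub h hlt.le, inv_mul_cancel_left] at h2
  rw [Finset.mem_range] at hi hj
  obtain ⟨k, hk⟩ := Nat.dvd_factorial (show 0 < j - i by omega) (show j - i ≤ R.card by omega)
  rw [hk, pow_mul]
  exact V.pow_mem h1 k

theorem CoveredBy.finite_quotient {V : Subgroup G} {N : ℕ} (h : CoveredBy ⊤ V N) :
    Finite (G ⧸ V) ∧ Nat.card (G ⧸ V) ≤ N := by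
  obtain ⟨R, hRN, hR⟩ := h
  have hs : Function.Surjective fun r : R => (QuotientGroup.mk (r : G) : G ⧸ V) := by
    intro q
    obtain ⟨y, rfl⟩ := QuotientGroup.mk_surjective q
    obtain ⟨r, hr, hr'⟩ := hR y (Subgroup.mem_top y)
    exact ⟨⟨r, hr⟩, QuotientGroup.eq.2 hr'⟩
  refine ⟨Finite.of_surjective _ hs, (Nat.card_le_card_of_surjective _ hs).trans ?_⟩
  simpa using hRN

/-! ### Polycyclic subgroups and separating polynomials. -/

/-- `K` is an extension of its normal subgroup `H` by a cyclic group generated by `x`. -/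
structure IsCyclicExtension (H K : Subgroup G) (x : G) : Prop where
  le : H ≤ K
  mem : x ∈ K
  exists_zpow : ∀ y ∈ K, ∃ j : ℤ, x ^ (-j) * y ∈ H
  conj_mem : ∀ y ∈ K, ∀ h ∈ H, y * h * y⁻¹ ∈ H

/-- The subgroups obtained from the trivial one by finitely many extensions by cyclic groups. -/
inductive IsPolycyclic : Subgroup G → Prop
  | bot : IsPolycyclic ⊥
  | step {H K : Subgroup G} {x : G} : IsPolycyclic H → IsCyclicExtension H K x → IsPolycyclic K

theorem IsPolycyclic.coveredBy {H V : Subgroup G} (hH : IsPolycyclic H) {m : ℕ} (hm : 0 < m)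
    (hpow : ∀ h ∈ H, h ^ m ∈ V) (hV : ∀ h ∈ H, ∀ v ∈ V, h⁻¹ * v * h ∈ V) :
    ∃ N, CoveredBy H V N := by
  induction hH with
  | bot => exact ⟨1, coveredBy_of_le bot_le⟩
  | step _ hx ih =>
    obtain ⟨N, hN⟩ := ih (fun h hh => hpow h (hx.le hh)) fun h hh => hV h (hx.le hh)
    exact ⟨_, hN.cyclic hm hx.exists_zpow (hpow _ hx.mem) fun h hh => hV h (hx.le hh)⟩

/-- There is a finite family of polynomial functions on `L` that separates the identity from the
other elements. -/
def HasSeparatingPolys (L : Subgroup G) : Prop :=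
  ∃ F : Set (G → ℤ), F.Finite ∧ (∀ f ∈ F, ∃ d, IsPolyOn L d f) ∧
    ∀ g ∈ L, (∀ f ∈ F, f g = f 1) → g = 1

theorem HasSeparatingPolys.mono {L K : Subgroup G} (hL : HasSeparatingPolys L) (h : K ≤ L) :
    HasSeparatingPolys K := by
  obtain ⟨F, hF, hp, hs⟩ := hL
  exact ⟨F, hF, fun f hf => (hp f hf).imp fun d hd => hd.mono_subgroup h,
    fun g hg => hs g (h hg)⟩

/-- The product of a subgroup `N` and the cyclic group generated by an element `x` that
normalizes it. -/
def mulZPowers (N : Subgroup G) (x : G) (hx : ∀ j : ℤ, ∀ n ∈ N, x ^ j * n * x ^ (-j) ∈ N) :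
    Subgroup G where
  carrier := {z | ∃ j : ℤ, z * x ^ (-j) ∈ N}
  one_mem' := ⟨0, by simp⟩
  mul_mem' := by
    rintro a b ⟨i, hi⟩ ⟨j, hj⟩
    refine ⟨i + j, ?_⟩
    have := N.mul_mem hi (hx i _ hj)
    convert this using 1
    group
  inv_mem' := by
    rintro a ⟨i, hi⟩
    refine ⟨-i, ?_⟩
    have := hx (-i) _ (N.inv_mem hi)
    convert this using 1
    group

theorem mem_mulZPowers {N : Subgroup G} {x : G}
    {hx : ∀ j : ℤ, ∀ n ∈ N, x ^ j * n * x ^ (-j) ∈ N} {z : G} :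
    z ∈ mulZPowers N x hx ↔ ∃ j : ℤ, z * x ^ (-j) ∈ N := Iff.rfl

/-- The exponent `κ` of `x` is a homomorphism, so adding it to the family forces `g` into `N`, where
the old functions, pulled back along `z ↦ z * x ^ (-κ z)`, finish. -/
theorem HasSeparatingPolys.mulZPowers {c : ℕ}
    (hc : (⊤ : Subgroup G).lowerCentralSeries c = ⊥) {N : Subgroup G} {x : G}
    (hN : HasSeparatingPolys N) (hx : ∀ j : ℤ, ∀ n ∈ N, x ^ j * n * x ^ (-j) ∈ N)
    (hinf : ∀ j : ℤ, x ^ j ∈ N → j = 0) : HasSeparatingPolys (mulZPowers N x hx) := by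
  obtain ⟨F, hF, hp, hs⟩ := hN
  set L := ResidualFiniteness.mulZPowers N x hx with hL
  choose! κ hκ using fun (z : G) (hz : z ∈ L) => mem_mulZPowers.1 hz
  have huniq : ∀ z ∈ L, ∀ j : ℤ, z * x ^ (-j) ∈ N → κ z = j := by
    intro z hz j hj
    have h1 := N.mul_mem (N.inv_mem (hκ z hz)) hj
    have h2 : (z * x ^ (-κ z))⁻¹ * (z * x ^ (-j)) = x ^ (κ z - j) := by group
    rw [h2] at h1
    exact sub_eq_zero.1 (hinf _ h1)
  have hNL : N ≤ L := fun n hn => ⟨0, by simpa using hn⟩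
  have hκN : ∀ n ∈ N, κ n = 0 := fun n hn => huniq n (hNL hn) 0 (by simpa using hn)
  have hadd : ∀ y ∈ L, ∀ z ∈ L, κ (y * z) = κ y + κ z := by
    intro y hy z hz
    refine huniq _ (L.mul_mem hy hz) _ ?_
    have := N.mul_mem (hκ y hy) (hx (κ y) _ (hκ z hz))
    convert this using 1
    group
  have hconj : ∀ y ∈ L, ∀ z ∈ N, y * z * y⁻¹ ∈ N := by
    intro y hy z hz
    have h1 := hκ y hy
    have h2 := N.mul_mem (N.mul_mem h1 (hx (κ y) z hz)) (N.inv_mem h1)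
    convert h2 using 1
    group
  refine ⟨insert κ ((fun f z => f (z * x ^ (-κ z))) '' F), (hF.image _).insert _, ?_, ?_⟩
  · rintro f (rfl | ⟨f, hf, rfl⟩)
    · refine ⟨2, fun y hy => fun y' hy' z hz => ?_⟩
      simp only [hadd y hy z hz, hadd y hy _ (L.mul_mem hy' hz)]
      ring
    · obtain ⟨d, hd⟩ := hp f hf
      exact ⟨_, (hd.isWeightedOn hc le_rfl).isPolyOn_extend hadd hκ hNL hκN hconj⟩
  · intro g hg h
    have h0 : κ g = 0 := by
      rw [h κ (Set.mem_insert _ _), hκN 1 N.one_mem]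
    have hgN : g ∈ N := by simpa [h0] using hκ g hg
    refine hs g hgN fun f hf => ?_
    have := h _ (Set.mem_insert_of_mem _ (Set.mem_image_of_mem _ hf))
    simpa [h0, hκN 1 N.one_mem] using this

/-- A polycyclic subgroup of a nilpotent group has a subgroup of finite index that is separated by
finitely many polynomial functions. -/
theorem IsPolycyclic.exists_hasSeparatingPolys {c : ℕ}
    (hc : (⊤ : Subgroup G).lowerCentralSeries c = ⊥) {H : Subgroup G} (hH : IsPolycyclic H) :
    ∃ L, L ≤ H ∧ (∃ N, CoveredBy H L N) ∧ HasSeparatingPolys L := by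
  induction hH with
  | bot =>
    exact ⟨⊥, le_rfl, ⟨1, coveredBy_of_le le_rfl⟩, ∅, Set.finite_empty, by simp, by simp⟩
  | @step H K x hH hx ih =>
    obtain ⟨L, hLH, ⟨N, hN⟩, hs⟩ := ih
    -- If a positive power of `x` lies in `H`, then `H` has finite index in `K` and the old `L`
    -- still works.
    by_cases hq : ∃ q : ℕ, 0 < q ∧ x ^ q ∈ H
    · obtain ⟨q, hq0, hq⟩ := hq
      have h1 := (coveredBy_of_le (le_refl H)).cyclic hq0 hx.exists_zpow hq
        fun h hh v hv => H.mul_mem (H.mul_mem (H.inv_mem hh) hv) hh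
      exact ⟨L, hLH.trans hx.le, ⟨_, h1.trans hN⟩, hs⟩
    -- `L` need not be normalized by `K`, so it is replaced by the smaller `powSubgroup H m`, which
    -- is and which meets the powers of `x` trivially.
    · obtain ⟨m, hm, hmL⟩ := hN.exists_pow_mem
      have hVL : powSubgroup H m ≤ L := powSubgroup_le hmL
      have hV : ∀ y ∈ K, ∀ v ∈ powSubgroup H m, y * v * y⁻¹ ∈ powSubgroup H m :=
        fun y hy v hv => conj_mem_powSubgroup (hx.conj_mem y hy) hv
      have hxV : ∀ j : ℤ, ∀ n ∈ powSubgroup H m, x ^ j * n * x ^ (-j) ∈ powSubgroup H m := by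
        intro j n hn
        rw [zpow_neg]
        exact hV _ (K.zpow_mem hx.mem j) n hn
      have hinf : ∀ j : ℤ, x ^ j ∈ powSubgroup H m → j = 0 := by
        intro j hj
        by_contra hj0
        refine hq ⟨j.natAbs, by omega, ?_⟩
        rcases Int.natAbs_eq j with h | h <;> rw [h] at hj
        · rw [zpow_natCast] at hj
          exact hLH (hVL hj)
        · rw [zpow_neg, zpow_natCast, inv_mem_iff] at hj
          exact hLH (hVL hj)
      refine ⟨mulZPowers _ x hxV, ?_, ?_, (hs.mono hVL).mulZPowers hc hxV hinf⟩
      · rintro z ⟨j, hj⟩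
        have := K.mul_mem (hx.le (hLH (hVL hj))) (K.zpow_mem hx.mem j)
        simpa [mul_assoc] using this
      · obtain ⟨M, R, hRM, hR⟩ := hH.coveredBy hm (fun h hh => pow_mem_powSubgroup hh m)
          fun h hh v hv => by simpa using hV h⁻¹ (K.inv_mem (hx.le hh)) v hv
        refine ⟨M, R, hRM, fun y hy => ?_⟩
        obtain ⟨j, hj⟩ := hx.exists_zpow y hy
        have h1 := hx.conj_mem _ (K.zpow_mem hx.mem j) _ hj
        have h2 : x ^ j * (x ^ (-j) * y) * (x ^ j)⁻¹ = y * x ^ (-j) := by group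
        rw [h2] at h1
        obtain ⟨r, hr, hr'⟩ := hR _ h1
        exact ⟨r, hr, j, by simpa [mul_assoc] using hr'⟩

/-! ### A small prime not dividing a given integer. -/

/-- A weak form of Chebyshev's lower bound. -/
theorem exists_half_le_theta : ∃ N₀ : ℕ, ∀ n : ℕ, N₀ ≤ n → (n : ℝ) / 2 ≤ Chebyshev.theta n := by
  have h1 : (fun x : ℝ => √x * Real.log x) =o[Filter.atTop] fun x : ℝ => x := by
    have h := (Asymptotics.isBigO_refl (fun x : ℝ => √x) Filter.atTop).mul_isLittleO
      (isLittleO_log_rpow_atTop (show (0 : ℝ) < 1 / 2 by norm_num))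
    refine h.congr' Filter.EventuallyEq.rfl ?_
    filter_upwards [Filter.eventually_ge_atTop 0] with x hx
    rw [← Real.sqrt_eq_rpow, Real.mul_self_sqrt hx]
  have h2 := (h1.comp_tendsto tendsto_natCast_atTop_atTop).bound (show (0 : ℝ) < 1 / 50 by norm_num)
  have h3 := (Real.isLittleO_log_id_atTop.comp_tendsto
    tendsto_natCast_atTop_atTop).bound (show (0 : ℝ) < 1 / 50 by norm_num)
  obtain ⟨N₀, hN₀⟩ := Filter.eventually_atTop.1 (h2.and h3)
  refine ⟨N₀ + 1, fun n hn => ?_⟩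
  obtain ⟨h4, -⟩ := hN₀ n (by omega)
  obtain ⟨-, h5⟩ := hN₀ (n + 1) (by omega)
  have h6 := Chebyshev.theta_ge n
  have h7 := Real.log_two_gt_d9
  have hn1 : (1 : ℝ) ≤ n := by exact_mod_cast (by omega : 1 ≤ n)
  simp only [Function.comp, Real.norm_eq_abs, id, Nat.cast_add, Nat.cast_one] at h4 h5
  rw [abs_of_nonneg (show (0 : ℝ) ≤ n by linarith)] at h4
  rw [abs_of_nonneg (show (0 : ℝ) ≤ n + 1 by linarith)] at h5
  have h8 := (le_abs_self _).trans h4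
  have h9 := (le_abs_self _).trans h5
  nlinarith

/-- A nonzero integer of polynomial size in `n` is prime to some large prime of size `O(log n)`. -/
theorem exists_prime_not_dvd (C D d : ℕ) : ∃ K : ℕ, 3 ≤ K ∧ ∀ n : ℕ, 0 < n → ∀ x : ℤ, x ≠ 0 →
    |x| ≤ C * (n + 1) ^ D →
    ∃ p : ℕ, p.Prime ∧ d ≤ p ∧ ¬ (p : ℤ) ∣ x ∧ (p : ℝ) ≤ K * Real.log (K * n) := by
  obtain ⟨N₀, hN₀⟩ := exists_half_le_theta
  set A : ℝ := 2 * Real.log C + 2 * Chebyshev.theta d + N₀ + 2 with hA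
  have hθ := Chebyshev.theta_nonneg d
  have hC := Real.log_natCast_nonneg C
  refine ⟨⌈A⌉₊ + 2 * D + 3, by omega, fun n hn x hx hxC => ?_⟩
  have hx1 : (1 : ℝ) ≤ x.natAbs := by exact_mod_cast Int.natAbs_pos.2 hx
  have hX : 0 ≤ Real.log x.natAbs := Real.log_nonneg hx1
  -- Chosen so that `M / 2` exceeds `log |x| + θ(d)`. If every prime in `[d, M]` divided `x`, so
  -- would their product, giving `θ(M) ≤ log |x| + θ(d)`; the summand `N₀` makes Chebyshev's bound
  -- apply.
  set M : ℕ := ⌈2 * (Real.log x.natAbs + Chebyshev.theta d)⌉₊ + N₀ + 1 with hM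
  have hMlt : 2 * (Real.log x.natAbs + Chebyshev.theta d) < M := by
    have := Nat.le_ceil (2 * (Real.log x.natAbs + Chebyshev.theta d))
    push_cast [hM]
    have : (0 : ℝ) ≤ N₀ := Nat.cast_nonneg _
    linarith
  have hMle : (M : ℝ) ≤ 2 * (Real.log x.natAbs + Chebyshev.theta d) + N₀ + 2 := by
    have := Nat.ceil_lt_add_one (show 0 ≤ 2 * (Real.log x.natAbs + Chebyshev.theta d) by positivity)
    push_cast [hM]
    linarith
  obtain ⟨p, hp, hdp, hpM, hpx⟩ : ∃ p : ℕ, p.Prime ∧ d ≤ p ∧ p ≤ M ∧ ¬ (p : ℤ) ∣ x := by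
    by_contra! hcon
    have h1 := hN₀ M (by omega)
    rw [Chebyshev.theta_eq_sum_primesLE_log,
      ← Finset.sum_filter_add_sum_filter_not _ (fun p => d ≤ p)] at h1
    have h2 : ∑ p ∈ (Nat.primesLE M).filter (fun p => ¬ d ≤ p), Real.log p
        ≤ Chebyshev.theta d := by
      rw [Chebyshev.theta_eq_sum_primesLE_log]
      refine Finset.sum_le_sum_of_subset_of_nonneg (fun p hp => ?_)
        fun p _ _ => Real.log_natCast_nonneg p
      simp only [Finset.mem_filter, Nat.mem_primesLE] at hp ⊢
      exact ⟨by omega, hp.1.2⟩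
    have h3 : ∑ p ∈ (Nat.primesLE M).filter (fun p => d ≤ p), Real.log p
        ≤ Real.log x.natAbs := by
      rw [← Real.log_prod fun p hp => by
        simp only [Finset.mem_filter, Nat.mem_primesLE] at hp
        exact_mod_cast hp.1.2.ne_zero]
      have hdvd : ∏ p ∈ (Nat.primesLE M).filter (fun p => d ≤ p), p ∣ x.natAbs := by
        refine Finset.prod_primes_dvd _ (fun p hp => ?_) fun p hp => ?_ <;>
          simp only [Finset.mem_filter, Nat.mem_primesLE] at hp
        · exact hp.1.2.prime
        · exact Int.natCast_dvd.1 (hcon p hp.1.2 hp.2 hp.1.1)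
      have hle := Nat.le_of_dvd (Int.natAbs_pos.2 hx) hdvd
      refine Real.log_le_log ?_ (by rw [← Nat.cast_prod]; exact Nat.cast_le.2 hle)
      refine Finset.prod_pos fun p hp => ?_
      simp only [Finset.mem_filter, Nat.mem_primesLE] at hp
      exact_mod_cast hp.1.2.pos
    linarith
  refine ⟨p, hp, hdp, hpx, ?_⟩
  have hn1 : (1 : ℝ) ≤ n := by exact_mod_cast hn
  have hC0 : (C : ℝ) ≠ 0 := by
    rintro h
    have : C = 0 := by exact_mod_cast h
    simp [this, hx] at hxC
  have hlogx : Real.log x.natAbs ≤ Real.log C + D * Real.log (n + 1) := by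
    rw [← Real.log_pow, ← Real.log_mul hC0 (by positivity)]
    refine Real.log_le_log (by linarith) ?_
    rw [Nat.cast_natAbs]
    exact_mod_cast hxC
  set K : ℕ := ⌈A⌉₊ + 2 * D + 3 with hK
  have hAK : A + 2 * D ≤ K := by
    have := Nat.le_ceil A
    push_cast [hK]
    linarith
  have hK3 : (3 : ℝ) ≤ K := by exact_mod_cast (by omega : 3 ≤ K)
  -- `K ≥ 3 > e` makes the logarithm at least `1`, so it absorbs the additive constant `A`.
  have hl1 : 1 ≤ Real.log (K * n) := by
    rw [Real.le_log_iff_exp_le (by positivity)]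
    have := Real.exp_one_lt_d9
    nlinarith
  have hl2 : Real.log (n + 1) ≤ Real.log (K * n) :=
    Real.log_le_log (by positivity) (by nlinarith)
  have hA0 : 0 ≤ A := by positivity
  have hpM' : (p : ℝ) ≤ M := by exact_mod_cast hpM
  calc (p : ℝ) ≤ A + 2 * D * Real.log (n + 1) := by rw [hA]; linarith
    _ ≤ A * Real.log (K * n) + 2 * D * Real.log (K * n) := by
        gcongr
        exact le_mul_of_one_le_right hA0 hl1
    _ = (A + 2 * D) * Real.log (K * n) := by ring
    _ ≤ K * Real.log (K * n) := by gcongr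

/-! ### Finitely generated nilpotent groups are polycyclic. -/

/-- The lower central factors of a finitely generated group are finitely generated. -/
theorem exists_finite_lowerCentralSeries_eq {S : Set G} (hS : S.Finite)
    (hgen : Subgroup.closure S = ⊤) (i : ℕ) : ∃ X : Set G, X.Finite ∧
      (⊤ : Subgroup G).lowerCentralSeries i
        = Subgroup.closure X ⊔ (⊤ : Subgroup G).lowerCentralSeries (i + 1) := by
  induction i with
  | zero => exact ⟨S, hS, by simp [hgen]⟩
  | succ i ih =>
    obtain ⟨X, hX, hXi⟩ := ih
    set γ := (⊤ : Subgroup G).lowerCentralSeries with hγ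
    have hanti : Antitone γ := Subgroup.lowerCentralSeries_antitone _
    have hcomm : ∀ j, ∀ a ∈ γ j, ∀ b, ⁅a, b⁆ ∈ γ (j + 1) := fun j a ha b =>
      Subgroup.commutator_mem_commutator ha (Subgroup.mem_top b)
    have hXle : ∀ x ∈ X, x ∈ γ i := fun x hx => by
      rw [hXi]; exact Subgroup.mem_sup_left (Subgroup.subset_closure hx)
    set Y := Set.image2 (fun x s => ⁅x, s⁆) X S with hY
    refine ⟨Y, hX.image2 _ hS, ?_⟩
    set M := Subgroup.closure Y ⊔ γ (i + 1 + 1) with hM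
    have hMle : M ≤ γ (i + 1) := by
      refine sup_le ((Subgroup.closure_le _).2 ?_) (hanti (Nat.le_succ _))
      rintro _ ⟨x, hx, s, -, rfl⟩
      exact hcomm i x (hXle x hx) s
    have hMcomm : ∀ a ∈ γ (i + 1), ∀ b, ⁅a, b⁆ ∈ M := fun a ha b =>
      Subgroup.mem_sup_right (hcomm _ a ha b)
    have hMn : M.Normal := by
      refine ⟨fun n hn g => ?_⟩
      have h3 := M.mul_mem hn (hMcomm n⁻¹ (hMle (M.inv_mem hn)) g)
      rw [commutatorElement_def] at h3
      have : n * (n⁻¹ * g * n⁻¹⁻¹ * g⁻¹) = g * n * g⁻¹ := by group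
      rwa [this] at h3
    refine le_antisymm ?_ hMle
    -- modulo `M`, the generators of `γ i` are central
    have hcen : ∀ a ∈ γ i, QuotientGroup.mk' M a ∈ Subgroup.center (G ⧸ M) := by
      have hcrit : ∀ a b : G, ⁅a, b⁆ ∈ M → Commute (QuotientGroup.mk' M a)
          (QuotientGroup.mk' M b) := fun a b h => by
        rw [← commutatorElement_eq_one_iff_commute, ← map_commutatorElement]
        exact (QuotientGroup.eq_one_iff _).2 h
      suffices h : γ i ≤ (Subgroup.center (G ⧸ M)).comap (QuotientGroup.mk' M) from
        fun a ha => h ha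
      rw [hXi]
      refine sup_le ((Subgroup.closure_le _).2 fun x hx => ?_) fun a ha => ?_
      · rw [SetLike.mem_coe, Subgroup.mem_comap, Subgroup.mem_center_iff]
        suffices h : (⊤ : Subgroup G) ≤ (Subgroup.centralizer {QuotientGroup.mk' M x}).comap
            (QuotientGroup.mk' M) by
          intro q
          obtain ⟨b, rfl⟩ := QuotientGroup.mk'_surjective M q
          exact (Subgroup.mem_centralizer_iff.1 (h (Subgroup.mem_top b)) _ rfl).symm
        rw [← hgen, Subgroup.closure_le]
        intro s hs
        rw [SetLike.mem_coe, Subgroup.mem_comap, Subgroup.mem_centralizer_iff]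
        rintro _ rfl
        exact hcrit x s (Subgroup.mem_sup_left (Subgroup.subset_closure ⟨x, hx, s, hs, rfl⟩))
      · rw [Subgroup.mem_comap, Subgroup.mem_center_iff]
        intro q
        obtain ⟨b, rfl⟩ := QuotientGroup.mk'_surjective M q
        exact (hcrit a b (hMcomm a ha b)).symm
    refine Subgroup.commutator_le.2 fun a ha b _ => ?_
    have h1 := Subgroup.mem_center_iff.1 (hcen a ha) (QuotientGroup.mk' M b)
    have h2 : Commute (QuotientGroup.mk' M a) (QuotientGroup.mk' M b) := h1.symm
    rw [← commutatorElement_eq_one_iff_commute, ← map_commutatorElement] at h2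
    exact (QuotientGroup.eq_one_iff _).1 h2

/-- A finitely generated central extension of a polycyclic normal subgroup is polycyclic. -/
theorem IsPolycyclic.closure_sup {N : Subgroup G} (hN : IsPolycyclic N) [N.Normal]
    {X : Set G} (hX : X.Finite) (hcomm : ∀ k ∈ Subgroup.closure X ⊔ N, ∀ y : G, ⁅y, k⁆ ∈ N) :
    IsPolycyclic (Subgroup.closure X ⊔ N) := by
  induction X, hX using Set.Finite.induction_on with
  | empty => simpa using hN
  | @insert x X _ _ ih =>
    have hle : Subgroup.closure X ⊔ N ≤ Subgroup.closure (insert x X) ⊔ N :=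
      sup_le_sup_right (Subgroup.closure_mono (Set.subset_insert x X)) _
    have hn : (Subgroup.closure X ⊔ N).Normal := ⟨fun h hh y => by
      have := mul_mem (Subgroup.mem_sup_right (S := Subgroup.closure X) (hcomm h (hle hh) y)) hh
      simpa [commutatorElement_def] using this⟩
    refine (ih fun k hk => hcomm k (hle hk)).step (x := x) ⟨hle, ?_, fun y hy => ?_,
      fun y _ h hh => hn.conj_mem h hh y⟩
    · exact Subgroup.mem_sup_left (Subgroup.subset_closure (Set.mem_insert x X))
    · rw [Set.insert_eq, Subgroup.closure_union, ← Subgroup.zpowers_eq_closure, sup_assoc,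
        Subgroup.mem_sup_of_normal_right] at hy
      obtain ⟨_, ⟨j, rfl⟩, h, hh, rfl⟩ := hy
      exact ⟨j, by simpa using hh⟩

/-- Climb the lower central series from the bottom; each step is central modulo the previous term,
with finitely many new generators. -/
theorem isPolycyclic_top_of_isNilpotent {S : Set G} (hS : S.Finite)
    (hgen : Subgroup.closure S = ⊤) {c : ℕ}
    (hc : (⊤ : Subgroup G).lowerCentralSeries c = ⊥) : IsPolycyclic (⊤ : Subgroup G) := by
  suffices h : ∀ j ≤ c, IsPolycyclic ((⊤ : Subgroup G).lowerCentralSeries (c - j)) by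
    simpa using h c le_rfl
  intro j
  induction j with
  | zero => intro _; rw [Nat.sub_zero, hc]; exact .bot
  | succ j ih =>
    intro hj
    have h1 := ih (by omega)
    rw [show c - j = (c - (j + 1)) + 1 by omega] at h1
    obtain ⟨X, hX, hXe⟩ := exists_finite_lowerCentralSeries_eq hS hgen (c - (j + 1))
    rw [hXe]
    refine h1.closure_sup hX fun k hk y => ?_
    rw [← hXe] at hk
    rw [Subgroup.lowerCentralSeries_succ, Subgroup.commutator_comm]
    exact Subgroup.commutator_mem_commutator (Subgroup.mem_top y) hk

theorem IsPolycyclic.exists_series {H : Subgroup G} (hH : IsPolycyclic H) :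
    ∃ (n : ℕ) (t : ℕ → Subgroup G), t 0 = ⊥ ∧ t n = H ∧
      ∀ i < n, ∃ x, IsCyclicExtension (t i) (t (i + 1)) x := by
  induction hH with
  | bot => exact ⟨0, fun _ => ⊥, rfl, rfl, by simp⟩
  | @step H K x _ hx ih =>
    obtain ⟨n, t, h0, hn, ht⟩ := ih
    refine ⟨n + 1, fun i => if i ≤ n then t i else K, by simpa using h0, by simp, fun i hi => ?_⟩
    rcases Nat.lt_succ_iff_lt_or_eq.1 hi with h | rfl
    · simpa [h.le, Nat.succ_le_of_lt h] using ht i h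
    · exact ⟨x, by simpa [hn] using hx⟩

theorem IsCyclicExtension.normal {H K : Subgroup G} {x : G} (h : IsCyclicExtension H K x) :
    (H.subgroupOf K).Normal :=
  ⟨fun n hn g => by
    simpa [Subgroup.mem_subgroupOf] using h.conj_mem g g.2 n (Subgroup.mem_subgroupOf.1 hn)⟩

theorem IsCyclicExtension.isCyclic {H K : Subgroup G} {x : G} (h : IsCyclicExtension H K x)
    [(H.subgroupOf K).Normal] : IsCyclic (K ⧸ H.subgroupOf K) := by
  refine ⟨QuotientGroup.mk ⟨x, h.mem⟩, fun q => ?_⟩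
  obtain ⟨y, rfl⟩ := QuotientGroup.mk_surjective q
  obtain ⟨j, hj⟩ := h.exists_zpow y y.2
  refine ⟨j, ?_⟩
  change QuotientGroup.mk ((⟨x, h.mem⟩ : K) ^ j) = _
  rw [QuotientGroup.eq, Subgroup.mem_subgroupOf]
  simpa using hj

theorem IsPolycyclic.nonempty_series (h : IsPolycyclic (⊤ : Subgroup G)) :
    Nonempty (CyclicOrFiniteSeries G) := by
  obtain ⟨n, t, h0, hn, ht⟩ := h.exists_series
  choose! x hx using ht
  exact ⟨{
    length := n
    term := t
    term_zero := h0
    term_length := hn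
    le_succ := fun i hi => (hx i hi).le
    normal := fun i hi => (hx i hi).normal
    cyclic_or_finite := fun i hi =>
      Or.inl (haveI := (hx i hi).normal; (hx i hi).isCyclic) }⟩

theorem exists_zpow_of_isCyclic {H K : Subgroup G} [(H.subgroupOf K).Normal]
    [IsCyclic (K ⧸ H.subgroupOf K)] : ∃ x ∈ K, ∀ y ∈ K, ∃ j : ℤ, x ^ (-j) * y ∈ H := by
  obtain ⟨q, hq⟩ := IsCyclic.exists_generator (α := K ⧸ H.subgroupOf K)
  obtain ⟨x, rfl⟩ := QuotientGroup.mk_surjective q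
  refine ⟨x, x.2, fun y hy => ?_⟩
  obtain ⟨j, hj⟩ := hq (QuotientGroup.mk ⟨y, hy⟩)
  refine ⟨j, ?_⟩
  change QuotientGroup.mk (x ^ j) = _ at hj
  rw [QuotientGroup.eq, Subgroup.mem_subgroupOf] at hj
  simpa using hj

/-! ### Order of quotients by power subgroups. -/

open scoped Classical in
/-- The quotient by a normal subgroup that contains all `m`-th powers has order `O(m ^ h)`, where
`h` is the number of infinite factors of a series with cyclic or finite factors. -/
theorem CyclicOrFiniteSeries.exists_coveredBy (s : CyclicOrFiniteSeries G) :
    ∃ C : ℕ, ∀ (m : ℕ) (V : Subgroup G) [V.Normal], 0 < m → (∀ g : G, g ^ m ∈ V) →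
      CoveredBy ⊤ V (C * m ^ s.infiniteFactors) := by
  set Inf : ℕ → Prop := fun i => Infinite (s.term (i + 1) ⧸ (s.term i).subgroupOf (s.term (i + 1)))
    with hInf
  -- A finite layer costs its order, which is independent of `m` and goes into `C`; only an infinite
  -- layer costs a factor `m`.
  set a : ℕ → ℕ := fun i =>
    if Inf i then 1 else Nat.card (s.term (i + 1) ⧸ (s.term i).subgroupOf (s.term (i + 1))) with ha
  refine ⟨∏ i ∈ Finset.range s.length, a i, fun m V _ hm hV => ?_⟩
  have key : ∀ n ≤ s.length,
      CoveredBy (s.term n) V (∏ i ∈ Finset.range n, a i * if Inf i then m else 1) := by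
    intro n
    induction n with
    | zero =>
      intro _
      simpa [s.term_zero] using coveredBy_of_le (bot_le (a := V))
    | succ n ih =>
      intro hn
      have h1 := ih (by omega)
      rw [Finset.prod_range_succ, mul_comm]
      by_cases hi : Inf n
      · have := s.normal n hn
        have : IsCyclic (s.term (n + 1) ⧸ (s.term n).subgroupOf (s.term (n + 1))) :=
          (s.cyclic_or_finite n hn).resolve_right fun h => not_finite_iff_infinite.2 hi h
        obtain ⟨x, -, hx⟩ := exists_zpow_of_isCyclic (H := s.term n) (K := s.term (n + 1))
        have h2 := h1.cyclic hm hx (hV x) fun h _ v hv => by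
          simpa using (inferInstance : V.Normal).conj_mem v hv h⁻¹
        simpa [ha, hi] using h2
      · have : Finite (s.term (n + 1) ⧸ (s.term n).subgroupOf (s.term (n + 1))) :=
          not_infinite_iff_finite.1 hi
        have h2 := (coveredBy_of_finite (s.term (n + 1)) (s.term n)).trans h1
        simpa [ha, hi] using h2
  have h := key s.length le_rfl
  rw [s.term_length, Finset.prod_mul_distrib, ← Finset.prod_filter, Finset.prod_const] at h
  have hcard : s.infiniteFactors = ((Finset.range s.length).filter Inf).card := by
    rw [CyclicOrFiniteSeries.infiniteFactors, ← Set.ncard_coe_finset]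
    congr 1
    ext i
    simp [hInf]
  rwa [hcard]

/-! ### Short elements and the final estimate. -/

theorem exists_list_of_wordLength_le {S : Set G} {g : G} {n : ℕ} (h : wordLength S g ≤ n) :
    ∃ l : List G, (∀ x ∈ l, x ∈ S ∨ x⁻¹ ∈ S) ∧ l.prod = g ∧ l.length ≤ n := by
  by_contra! hcon
  have : ((n + 1 : ℕ) : ℕ∞) ≤ wordLength S g :=
    le_iInf₂ fun l hl => Nat.cast_le.2 (hcon l hl.1 hl.2)
  have := this.trans h
  rw [Nat.cast_le] at this
  omega

/-- Rewriting words along a finite transversal of `L`: an element of `L` of word length `n` is a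
product of `n + 1` elements of a finite subset of `L`. -/
theorem CoveredBy.exists_finset_prod {L : Subgroup G} {N : ℕ} (hL : CoveredBy ⊤ L N) {S : Set G}
    (hS : S.Finite) : ∃ U : Finset G, (∀ u ∈ U, u ∈ L) ∧ ∀ l : List G,
      (∀ x ∈ l, x ∈ S ∨ x⁻¹ ∈ S) → l.prod ∈ L →
      ∃ l' : List G, (∀ u ∈ l', u ∈ U) ∧ l'.prod = l.prod ∧ l'.length = l.length + 1 := by
  classical
  obtain ⟨R, -, hR⟩ := hL
  set R' : Finset G := insert 1 (R.image (·⁻¹)) with hR'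
  set A : Finset G := hS.toFinset ∪ hS.toFinset.image (·⁻¹) with hA
  set U : Finset G := (Finset.image₂ (· * ·) (Finset.image₂ (· * ·) R' A) (R'.image (·⁻¹)) ∪
    R').filter (· ∈ L) with hU
  refine ⟨U, fun u hu => (Finset.mem_filter.1 hu).2, fun l hl hlL => ?_⟩
  -- Reidemeister–Schreier rewriting: a representative is carried along the word, each letter
  -- emitting an element of `L`. Starting from `1`, the last representative lies in `L` and becomes
  -- the extra letter.
  have key : ∀ l : List G, (∀ x ∈ l, x ∈ S ∨ x⁻¹ ∈ S) → ∀ r ∈ R', ∃ l' : List G, ∃ r' ∈ R',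
      (∀ u ∈ l', u ∈ U) ∧ r * l.prod = l'.prod * r' ∧ l'.length = l.length := by
    intro l
    induction l with
    | nil => exact fun _ r hr => ⟨[], r, hr, by simp⟩
    | cons x l ih =>
      intro hl r hr
      have hx : x ∈ A := by
        rw [hA, Finset.mem_union, Finset.mem_image]
        rcases hl x (by simp) with h | h
        · exact Or.inl (by simpa using h)
        · exact Or.inr ⟨x⁻¹, by simpa using h, inv_inv x⟩
      obtain ⟨t, ht, htL⟩ := hR (r * x)⁻¹ (Subgroup.mem_top _)
      have ht' : t⁻¹ ∈ R' := Finset.mem_insert_of_mem (Finset.mem_image_of_mem _ ht)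
      obtain ⟨l', r', hr', hl', he, hlen⟩ := ih (fun y hy => hl y (by simp [hy])) t⁻¹ ht'
      refine ⟨r * x * (t⁻¹)⁻¹ :: l', r', hr', ?_, ?_, by simp [hlen]⟩
      · intro u hu
        rcases List.mem_cons.1 hu with rfl | hu
        · refine Finset.mem_filter.2 ⟨Finset.mem_union_left _ (Finset.mem_image₂_of_mem
            (Finset.mem_image₂_of_mem hr hx) (Finset.mem_image_of_mem _ ht')), ?_⟩
          have := L.inv_mem htL
          rw [mul_inv_rev, inv_inv, inv_inv] at this
          rwa [inv_inv]
        · exact hl' u hu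
      · rw [List.prod_cons, List.prod_cons, mul_assoc _ l'.prod, ← he]
        group
  obtain ⟨l', r', hr', hl', he, hlen⟩ := key l hl 1 (Finset.mem_insert_self _ _)
  rw [one_mul] at he
  refine ⟨l' ++ [r'], ?_, by simp [he], by simp [hlen]⟩
  intro u hu
  rcases List.mem_append.1 hu with hu | hu
  · exact hl' u hu
  · rw [List.mem_singleton.1 hu]
    refine Finset.mem_filter.2 ⟨Finset.mem_union_right _ hr', ?_⟩
    have h1 : l'.prod ∈ L := L.list_prod_mem fun u hu => (Finset.mem_filter.1 (hl' u hu)).2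
    rw [he] at hlL
    exact (L.mul_mem_cancel_left h1).1 hlL

/-- Short elements at which a polynomial function on a subgroup of finite index differs from its
value at the identity survive modulo the `p`-th powers for some small prime `p`. -/
theorem IsPolyOn.exists_prime_notMem {L : Subgroup G} {N d : ℕ} {f : G → ℤ} (hf : IsPolyOn L d f)
    (hL : CoveredBy ⊤ L N) {S : Set G} (hS : S.Finite) :
    ∃ K : ℕ, 3 ≤ K ∧ ∀ n : ℕ, 0 < n → ∀ g ∈ L, wordLength S g ≤ n → f g ≠ f 1 →
      ∃ p : ℕ, p.Prime ∧ g ∉ powSubgroup L p ∧ (p : ℝ) ≤ K * Real.log (K * n) := by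
  obtain ⟨U, hUL, hU⟩ := hL.exists_finset_prod hS
  obtain ⟨C, hC⟩ := hf.growth U hUL
  -- `2 ^ d` accounts for the extra letter after rewriting, and `(f 1).natAbs` for subtracting `f
  -- 1`.
  obtain ⟨K, hK3, hK⟩ := exists_prime_not_dvd (C * 2 ^ d + (f 1).natAbs) d d
  refine ⟨K, hK3, fun n hn g hg hgn hfg => ?_⟩
  obtain ⟨l, hl, rfl, hln⟩ := exists_list_of_wordLength_le hgn
  obtain ⟨l', hl', he, hlen⟩ := hU l hl hg
  have h1 := hC l' hl'
  rw [he, hlen] at h1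
  have h2 : ((l.length + 1 : ℕ) + 1 : ℤ) ≤ 2 * (n + 1) := by push_cast; omega
  have h3 : ((l.length + 1 : ℕ) + 1 : ℤ) ^ d ≤ 2 ^ d * (n + 1) ^ d := by
    rw [← mul_pow]
    gcongr
  have h4 : (C : ℤ) * ((l.length + 1 : ℕ) + 1 : ℤ) ^ d ≤ C * (2 ^ d * (n + 1) ^ d) := by gcongr
  have h5 : (1 : ℤ) ≤ ((n : ℤ) + 1) ^ d := one_le_pow₀ (by omega)
  have h6 := abs_sub (f l.prod) (f 1)
  have h7 : |f 1| ≤ |f 1| * ((n : ℤ) + 1) ^ d := le_mul_of_one_le_right (abs_nonneg _) h5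
  obtain ⟨p, hp, hdp, hpx, hpK⟩ := hK n hn (f l.prod - f 1) (sub_ne_zero.2 hfg) (by
    push_cast
    rw [add_mul, mul_assoc]
    linarith)
  exact ⟨p, hp, fun hmem => hpx (hf.dvd_of_mem_powSubgroup hp hdp hmem), hpK⟩

theorem minQuotient_le {g : G} {V : Subgroup G} [V.Normal] {N : ℕ} (hV : CoveredBy ⊤ V N)
    (hg : g ∉ V) : minQuotient g ≤ N := by
  obtain ⟨hfin, hcard⟩ := hV.finite_quotient
  exact (iInf₂_le V ⟨inferInstance, hfin, hg⟩).trans (Nat.cast_le.2 hcard)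

instance powSubgroup_top_normal (m : ℕ) : (powSubgroup (⊤ : Subgroup G) m).Normal :=
  ⟨fun _ hv _ => conj_mem_powSubgroup (fun _ _ => Subgroup.mem_top _) hv⟩

/-- In a finitely generated nilpotent group, an element of word length at most `n` survives modulo
the `m * p`-th powers for a constant `m` and some number `p` of size `O(log n)`. -/
theorem exists_notMem_powSubgroup (hG : Group.IsNilpotent G) {S : Set G} (hS : S.Finite)
    (hgen : Subgroup.closure S = ⊤) : ∃ m K : ℕ, 0 < m ∧ 3 ≤ K ∧ ∀ n : ℕ, 0 < n → ∀ g : G,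
      g ≠ 1 → wordLength S g ≤ n → ∃ p : ℕ, 0 < p ∧ g ∉ powSubgroup (⊤ : Subgroup G) (m * p) ∧
        (p : ℝ) ≤ K * Real.log (K * n) := by
  obtain ⟨c, hc⟩ := Subgroup.nilpotent_iff_lowerCentralSeries.1 hG
  obtain ⟨L, -, ⟨N, hN⟩, F, hF, hpoly, hsep⟩ :=
    (isPolycyclic_top_of_isNilpotent hS hgen hc).exists_hasSeparatingPolys hc
  obtain ⟨m, hm, hmL⟩ := hN.exists_pow_mem
  choose! d hd using hpoly
  choose! K hK3 hK using fun f hf => (hd f hf).exists_prime_notMem hN hS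
  obtain ⟨B, hB⟩ := (hF.image K).bddAbove
  refine ⟨m, B + 3, hm, by omega, fun n hn g hg hgn => ?_⟩
  have hn1 : (1 : ℝ) ≤ n := by exact_mod_cast hn
  have hle : ∀ p : ℕ, powSubgroup (⊤ : Subgroup G) (m * p) ≤ powSubgroup L p := fun p =>
    powSubgroup_le fun x hx => by
      rw [pow_mul]
      exact pow_mem_powSubgroup (hmL x hx) p
  by_cases hgL : g ∈ L
  · obtain ⟨f, hf, hfg⟩ : ∃ f ∈ F, f g ≠ f 1 := by
      by_contra! h
      exact hg (hsep g hgL h)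
    obtain ⟨p, hp, hgp, hpK⟩ := hK f hf n hn g hgL hgn hfg
    refine ⟨p, hp.pos, fun h => hgp (hle p h), hpK.trans ?_⟩
    have h1 : (K f : ℝ) ≤ (B + 3 : ℕ) := by
      exact_mod_cast (hB (Set.mem_image_of_mem K hf)).trans (Nat.le_add_right B 3)
    have h2 : (3 : ℝ) ≤ K f := by exact_mod_cast hK3 f hf
    have h3 : 0 ≤ Real.log (K f * n) := Real.log_nonneg (by nlinarith)
    gcongr
  -- Outside `L` no prime is needed: `m`-th powers already lie in `L`.
  · refine ⟨1, one_pos, fun h => hgL ?_, ?_⟩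
    · have := powSubgroup_le (fun x hx => L.pow_mem hx 1) (hle 1 h)
      exact this
    · have h3 : (3 : ℝ) ≤ (B + 3 : ℕ) := by exact_mod_cast Nat.le_add_left 3 B
      have h1 : 1 ≤ Real.log ((B + 3 : ℕ) * n) := by
        rw [Real.le_log_iff_exp_le (by positivity)]
        have := Real.exp_one_lt_d9
        nlinarith
      push_cast at *
      nlinarith

end ResidualFiniteness

theorem theorem2 {P : Type*} [Group P] (hP : Group.IsNilpotent P)
    (S : Set P) (hS : S.Finite) (hgen : Subgroup.closure S = ⊤) :
    ResidualFiniteness.AsympLE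
      (fun n => ((ResidualFiniteness.growth S n : ℕ∞) : ENNReal))
      (fun n => ENNReal.ofReal (Real.log n ^ ResidualFiniteness.hirschNumber P)) := by
  open ResidualFiniteness in
  obtain ⟨c, hc⟩ := Subgroup.nilpotent_iff_lowerCentralSeries.1 hP
  -- Without a series the infimum would take the default value `0`; with one, it is attained by some
  -- `s`.
  have hne : (Set.range (CyclicOrFiniteSeries.infiniteFactors (G := P))).Nonempty :=
    Set.range_nonempty_iff_nonempty.2
      (isPolycyclic_top_of_isNilpotent hS hgen hc).nonempty_series
  obtain ⟨s, hs⟩ := Nat.sInf_mem hne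
  obtain ⟨C, hC⟩ := s.exists_coveredBy
  obtain ⟨m, K, hm, hK3, hK⟩ := exists_notMem_powSubgroup hP hS hgen
  rw [hs] at hC
  set h := hirschNumber P with hh
  change ∀ (m : ℕ) (V : Subgroup P) [V.Normal], 0 < m → (∀ g : P, g ^ m ∈ V) →
      CoveredBy ⊤ V (C * m ^ h) at hC
  -- The first summand absorbs the multiplicative constants; the second gives `K ≤ D` inside the
  -- logarithm and makes `D` positive.
  set D := C * (m * K) ^ h + K with hD
  refine ⟨D, by omega, fun n hn => ?_⟩
  have hn1 : (1 : ℝ) ≤ n := by exact_mod_cast hn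
  have hK3' : (3 : ℝ) ≤ K := by exact_mod_cast hK3
  have hlog : 0 ≤ Real.log (K * n) := Real.log_nonneg (by nlinarith)
  have hKD : (K : ℝ) ≤ D := by exact_mod_cast (by omega : K ≤ D)
  have hlogD : Real.log (K * n) ≤ Real.log (D * n) := by gcongr
  set B : ℝ := D * Real.log (D * n) ^ h with hB
  have hbound : growth S n ≤ (⌊B⌋₊ : ℕ∞) := by
    refine iSup₂_le fun g hg => ?_
    obtain ⟨p, hp, hgp, hpK⟩ := hK n hn g hg.1 hg.2
    refine (minQuotient_le (hC (m * p) _ (Nat.mul_pos hm hp)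
      fun g => pow_mem_powSubgroup (Subgroup.mem_top g) _) hgp).trans ?_
    rw [Nat.cast_le]
    refine Nat.le_floor ?_
    have h1 : (m * p : ℝ) ≤ m * K * Real.log (D * n) := by
      rw [mul_assoc]
      gcongr
      exact hpK.trans (by gcongr)
    have h2 : (C * (m * K) ^ h : ℝ) ≤ D := by
      exact_mod_cast (by omega : C * (m * K) ^ h ≤ D)
    have h3 : 0 ≤ Real.log (D * n) := hlog.trans hlogD
    calc ((C * (m * p) ^ h : ℕ) : ℝ) = C * (m * p : ℝ) ^ h := by push_cast; ring
      _ ≤ C * (m * K * Real.log (D * n)) ^ h := by gcongr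
      _ = C * (m * K) ^ h * Real.log (D * n) ^ h := by rw [mul_pow]; ring
      _ ≤ B := by rw [hB]; gcongr
  have hB0 : 0 ≤ B := by
    have : 0 ≤ Real.log (D * n) := hlog.trans hlogD
    positivity
  calc ((growth S n : ℕ∞) : ENNReal) ≤ ((⌊B⌋₊ : ℕ∞) : ENNReal) := ENat.toENNReal_le.2 hbound
    _ = ENNReal.ofReal (⌊B⌋₊ : ℝ) := by simp
    _ ≤ ENNReal.ofReal B := ENNReal.ofReal_le_ofReal (Nat.floor_le hB0)
    _ = D * ENNReal.ofReal (Real.log ((D * n : ℕ) : ℝ) ^ h) := by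
        rw [hB, ENNReal.ofReal_mul (Nat.cast_nonneg D), ENNReal.ofReal_natCast, Nat.cast_mul]
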